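/- Let $P_\omega:\mathbf{Set}\to\mathbf{Set}$ be the finite powerset functor ($P_\omega X$ is the set of finite subsets of $X$, and maps act by direct image). For a set endofunctor $F$, let $\mathbf{Set}_F$ be the category of $F$-coalgebras $\alpha:A\to FA$. Call $F$ *nontrivial* if $FX=\emptyset$ implies $X=\emptyset$; *bounded* if there is a cardinal $\kappa$ such that every element of every $F$-coalgebra lies in a subcoalgebra of cardinality at most $\kappa$; and say that $F$ *weakly preserves pullbacks* if it sends pullback squares to weak pullback squares. If $\mathbf{Set}_F$ has finite limits, let $\mathbf{Pfn}_F$ be the category of $F$-coalgebras and partial morphisms: a morphism $X\rightharpoonup Y$ is a class $\{m,\varphi\}$ of pairs consisting of a monomorphism $m:U\to X$ and a morphism $\varphi:U\to Y$ of $\mathbf{Set}_F$, up to isomorphism of $U$, and composition is by pullback. Its zero morphisms are the classes $\{\emptyset\to X,\ \emptyset\to Y\}$. The product of $\mathbf{Set}_F$ extends to $\mathbf{Pfn}_F$ by $X\boxtimes Y=X\times Y$ and $\{m,\varphi\}\boxtimes\{m',\varphi'\}=\{m\times m',\varphi\times\varphi'\}$, with the diagonals $\Delta$ and projections $p_0,p_1$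 of $\mathbf{Set}_F$ regarded as total partial morphisms. Write $\langle f,g\rangle=(f\boxtimes g)\circ\Delta$. A *P-category* is a category with a bifunctor $\boxtimes$, a natural transformation $\Delta_X:X\to X\boxtimes X$ and morphisms $p_0:X\boxtimes Y\to X$, $p_1:X\boxtimes Y\to Y$ such that: $p_i\Delta_X=1_X$ and $(p_0\boxtimes p_1)\Delta_{X\boxtimes Y}=1_{X\boxtimes Y}$; if $\mathbf P$ is the smallest subcategory closed under $\boxtimes$ and containing all $p_0,p_1$, then $p_0$ is natural with respect to all pairs $(f,g)$ with $g$ in $\mathbf P$, and $p_1$ with respect to all pairs $(f,g)$ with $f$ in $\mathbf P$; the morphisms $\langle p_0p_0,\langle p_1p_0,p_1\rangle\rangle:(X\boxtimes Y)\boxtimes Z\to X\boxtimes(Y\boxtimes Z)$ and $\langle p_1,p_0\rangle:X\boxtimes Y\to Y\boxtimes X$ are natural isomorphisms, the latter composing with its transpose to the identity, and they satisfy the pentagon and hexagon conditions. A P-category is *prodominical* if it has zero morphisms and $\varphi\boxtimes 0=0$ for every morphism $\varphi$. A morphism $f:X\to Y$ is *total* if $p_0\circ\langle 1_X,f\rangle=1_X$,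 and *weakly total* if $f\varphi=0$ implies $\varphi=0$. A prodominical category is *dominical* if every weakly total morphism is total and $\varphi\boxtimes\psi=0$ implies $\varphi=0$ or $\psi=0$. **Proposition.** There exists a nontrivial, bounded set endofunctor $F$ that weakly preserves pullbacks such that $\mathbf{Pfn}_F$ is prodominical but not dominical. Namely, $F=P_\omega$ is nontrivial, bounded and weakly preserves pullbacks, $\mathbf{Set}_{P_\omega}$ has finite limits, and $\mathbf{Pfn}_{P_\omega}$, with the box product $\boxtimes$, is prodominical but not dominical. Moreover, there are nonempty finite $P_\omega$-coalgebras $A$, $B$ whose product $A\times B$ in $\mathbf{Set}_{P_\omega}$ is empty, and nonzero partial morphisms $\varphi:A\rightharpoonup A'$ and $\psi:B\rightharpoonup B'$ with $\varphi\boxtimes\psi=0$. -/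

import Mathlib

open CategoryTheory CategoryTheory.Limits

universe v u

noncomputable section

/-! ### Set endofunctors -/

/-- The finite powerset functor: `X` goes to the set of finite subsets of `X`, and a map `f` acts
by direct image. -/
def finPowerset : Type u ⥤ Type u where
  obj X := {s : Set X // s.Finite}
  map {X Y} f := TypeCat.ofHom fun s : {s : Set X // s.Finite} =>
    (⟨(fun x => f x) '' s.1, s.2.image _⟩ : {s : Set Y // s.Finite})
  map_id X := by
    ext s
    simp
  map_comp f g := by
    ext s
    simp [Set.image_image]

namespace SetEndofunctor

variable (F : Type u ⥤ Type u)

/-- `F` is nontrivial if `F X = ∅` implies `X = ∅`. -/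
def IsNontrivial : Prop :=
  ∀ X : Type u, IsEmpty (F.obj X) → IsEmpty X

/-- `F` weakly preserves pullbacks if it sends pullback squares to weak pullback squares. -/
def WeaklyPreservesPullbacks : Prop :=
  ∀ ⦃X Y Z : Type u⦄ (f : X ⟶ Z) (g : Y ⟶ Z) (c : Cone (cospan f g)),
    Nonempty (IsLimit c) → Nonempty (IsWeakLimit (F.mapCone c))

variable {F}

/-- The subset `U` of the coalgebra `A` is a subcoalgebra: it carries a coalgebra structure for
which the inclusion is a coalgebra morphism. -/
def IsSubcoalgebra (A : Endofunctor.Coalgebra F) (U : Set A.V) : Prop :=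
  ∃ β : (U : Type u) ⟶ F.obj U,
    β ≫ F.map (TypeCat.ofHom (Subtype.val : U → A.V)) =
      TypeCat.ofHom (Subtype.val : U → A.V) ≫ A.str

variable (F)

/-- `F` is bounded: for some cardinal `κ`, every element of every `F`-coalgebra lies in a
subcoalgebra of cardinality at most `κ`. -/
def IsBounded : Prop :=
  ∃ κ : Cardinal.{u}, ∀ (A : Endofunctor.Coalgebra F) (a : A.V),
    ∃ U : Set A.V, a ∈ U ∧ IsSubcoalgebra A U ∧ Cardinal.mk U ≤ κ

end SetEndofunctor

/-! ### Partial morphisms -/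

section PartialMorphisms

variable {C : Type u} [Category.{v} C]

/-- A pair `(m, φ)` with `m : U ⟶ X` a monomorphism and `φ : U ⟶ Y`. -/
structure PartialRep (X Y : C) where
  /-- the domain of definition `U` -/
  dom : C
  /-- the monomorphism `m` -/
  ι : dom ⟶ X
  /-- the morphism `φ` -/
  map : dom ⟶ Y
  mono : Mono ι

attribute [instance] PartialRep.mono

/-- Two pairs are equivalent if an isomorphism of their domains commutes with both legs. -/
instance PartialRep.setoid (X Y : C) : Setoid (PartialRep X Y) where
  r a b := ∃ θ : a.dom ≅ b.dom, θ.hom ≫ b.ι = a.ι ∧ θ.hom ≫ b.map = a.map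
  iseqv :=
    { refl := fun a => ⟨Iso.refl _, by simp, by simp⟩
      symm := by
        rintro a b ⟨θ, h₁, h₂⟩
        exact ⟨θ.symm, by simp [← h₁], by simp [← h₂]⟩
      trans := by
        rintro a b c ⟨θ, h₁, h₂⟩ ⟨η, k₁, k₂⟩
        exact ⟨θ ≪≫ η, by simp [k₁, h₁], by simp [k₂, h₂]⟩ }

/-- Partial morphisms `X ⇀ Y`: equivalence classes `{m, φ}` of pairs. -/
def PartialMor (X Y : C) := Quotient (PartialRep.setoid X Y)

namespace PartialMor

/-- The class `{m, φ}`. -/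
def mk {X Y U : C} (m : U ⟶ X) [hm : Mono m] (φ : U ⟶ Y) : PartialMor X Y :=
  Quotient.mk _ ⟨U, m, φ, hm⟩

theorem mk_eq {X Y U U' : C} {m : U ⟶ X} [Mono m] {φ : U ⟶ Y} {m' : U' ⟶ X} [Mono m']
    {φ' : U' ⟶ Y} (θ : U ≅ U') (h₁ : θ.hom ≫ m' = m) (h₂ : θ.hom ≫ φ' = φ) :
    mk m φ = mk m' φ' :=
  Quotient.sound ⟨θ, h₁, h₂⟩

theorem ind {X Y : C} {p : PartialMor X Y → Prop}
    (h : ∀ (U : C) (m : U ⟶ X) [Mono m] (φ : U ⟶ Y), p (mk m φ)) (a : PartialMor X Y) : p a := by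
  induction a using Quotient.inductionOn with
  | h a =>
    obtain ⟨U, m, φ, hm⟩ := a
    exact h U m φ

variable [HasFiniteLimits C]

/-- Composition of partial morphisms (in diagrammatic order), by pullback. -/
def comp {X Y Z : C} (a : PartialMor X Y) (b : PartialMor Y Z) : PartialMor X Z :=
  Quotient.map₂
    (fun (r : PartialRep X Y) (s : PartialRep Y Z) =>
      (⟨pullback r.map s.ι, pullback.fst r.map s.ι ≫ r.ι, pullback.snd r.map s.ι ≫ s.map,
        mono_comp _ _⟩ : PartialRep X Z))
    (by
      rintro r r' ⟨θ, h₁, h₂⟩ s s' ⟨η, k₁, k₂⟩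
      refine ⟨asIso (pullback.map r.map s.ι r'.map s'.ι θ.hom η.hom (𝟙 _)
        (by simp [h₂]) (by simp [k₁])), ?_, ?_⟩
      · exact (pullback.lift_fst_assoc _ _ _ _).trans ((Category.assoc _ _ _).trans
          (congrArg (pullback.fst r.map s.ι ≫ ·) h₁))
      · exact (pullback.lift_snd_assoc _ _ _ _).trans ((Category.assoc _ _ _).trans
          (congrArg (pullback.snd r.map s.ι ≫ ·) k₂)))
    a b

theorem comp_mk {X Y Z U V W : C} {m : U ⟶ X} [Mono m] {φ : U ⟶ Y} {n : V ⟶ Y} [Mono n]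
    {ψ : V ⟶ Z} {p : W ⟶ U} {q : W ⟶ V} (h : IsPullback p q φ n) [Mono (p ≫ m)] :
    comp (mk m φ) (mk n ψ) = mk (p ≫ m) (q ≫ ψ) := by
  refine Quotient.sound ⟨h.isoPullback.symm, ?_, ?_⟩
  · simp
  · simp

/-- The extension `{m, φ} ⊠ {m', φ'} = {m × m', φ × φ'}` of the product of `C`. -/
def boxMap {X X' Y Y' : C} (a : PartialMor X X') (b : PartialMor Y Y') :
    PartialMor (X ⨯ Y) (X' ⨯ Y') :=
  Quotient.map₂
    (fun (r : PartialRep X X') (s : PartialRep Y Y') =>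
      (⟨r.dom ⨯ s.dom, prod.map r.ι s.ι, prod.map r.map s.map, inferInstance⟩ :
        PartialRep (X ⨯ Y) (X' ⨯ Y')))
    (by
      rintro r r' ⟨θ, h₁, h₂⟩ s s' ⟨η, k₁, k₂⟩
      refine ⟨prod.mapIso θ η, ?_, ?_⟩
      · simp [h₁, k₁]
      · simp [h₂, k₂])
    a b

end PartialMor

/-- The category of partial maps of `C` has the objects of `C` (wrapped, so that the two categories
are not confused), and partial morphisms defined on arbitrary monomorphisms as its morphisms. -/
@[ext]
structure Par (C : Type u) where
  /-- the underlying object of `C` -/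
  as : C

instance Par.category [HasFiniteLimits C] : Category (Par C) where
  Hom X Y := PartialMor X.as Y.as
  id X := PartialMor.mk (𝟙 X.as) (𝟙 X.as)
  comp a b := PartialMor.comp a b
  id_comp {X Y} a := by
    induction a using PartialMor.ind with
    | h U m φ =>
      have h : IsPullback m (𝟙 U) (𝟙 X.as) m := IsPullback.of_vert_isIso ⟨by simp⟩
      have : Mono (m ≫ 𝟙 X.as) := by simpa
      exact (PartialMor.comp_mk h).trans (PartialMor.mk_eq (Iso.refl _) (by simp) (by simp))
  comp_id {X Y} a := by
    induction a using PartialMor.ind with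
    | h U m φ =>
      have h : IsPullback (𝟙 U) φ φ (𝟙 Y.as) := IsPullback.of_horiz_isIso ⟨by simp⟩
      exact (PartialMor.comp_mk h).trans (PartialMor.mk_eq (Iso.refl _) (by simp) (by simp))
  assoc {X Y Z T} a b c := by
    induction a using PartialMor.ind with
    | h U m φ =>
    induction b using PartialMor.ind with
    | h V n ψ =>
    induction c using PartialMor.ind with
    | h W k χ =>
      have hP := IsPullback.of_hasPullback φ n
      have hQ := IsPullback.of_hasPullback ψ k
      have hB := IsPullback.of_hasPullback (pullback.snd φ n) (pullback.fst ψ k)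
      have hL := hB.paste_vert hQ
      have hR := hB.flip.paste_vert hP.flip
      have : Mono (pullback.fst (pullback.snd φ n) (pullback.fst ψ k) ≫ pullback.fst φ n) :=
        mono_comp _ _
      rw [PartialMor.comp_mk hP, PartialMor.comp_mk hQ, PartialMor.comp_mk hL,
        PartialMor.comp_mk hR.flip]
      exact PartialMor.mk_eq (Iso.refl _) (by simp) (by simp)

end PartialMorphisms

/-! ### P-categories -/

/-- The data of a P-category on `C`: a near product `⊠` on objects and morphisms, diagonals
`Δ_X : X ⟶ X ⊠ X` and projections `p₀ : X ⊠ Y ⟶ X`, `p₁ : X ⊠ Y ⟶ Y`. The laws are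
`NearProduct.IsPCategory`. -/
structure NearProduct (C : Type u) [Category.{v} C] where
  /-- `X ⊠ Y` -/
  obj : C → C → C
  /-- `f ⊠ g` -/
  map : ∀ {X X' Y Y' : C}, (X ⟶ X') → (Y ⟶ Y') → (obj X Y ⟶ obj X' Y')
  /-- the components of the diagonal -/
  diag : ∀ X : C, X ⟶ obj X X
  /-- the components of the first projection -/
  p₀ : ∀ X Y : C, obj X Y ⟶ X
  /-- the components of the second projection -/
  p₁ : ∀ X Y : C, obj X Y ⟶ Y

namespace NearProduct

variable {C : Type u} [Category.{v} C] (P : NearProduct C)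

/-- `⟨f, g⟩ = (f ⊠ g) Δ_X`. -/
def pair {X Y Z : C} (f : X ⟶ Y) (g : X ⟶ Z) : X ⟶ P.obj Y Z :=
  P.diag X ≫ P.map f g

/-- The component at `X, Y, Z` of the associativity. -/
def ass (X Y Z : C) : P.obj (P.obj X Y) Z ⟶ P.obj X (P.obj Y Z) :=
  P.pair (P.p₀ (P.obj X Y) Z ≫ P.p₀ X Y)
    (P.pair (P.p₀ (P.obj X Y) Z ≫ P.p₁ X Y) (P.p₁ (P.obj X Y) Z))

/-- The component at `X, Y` of the transposition. -/
def tr (X Y : C) : P.obj X Y ⟶ P.obj Y X :=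
  P.pair (P.p₁ X Y) (P.p₀ X Y)

/-- The smallest subcategory that is closed under `⊠` and contains all the projections (every
object `X` is in it, being the codomain of a projection). -/
inductive Proj : ∀ {X Y : C}, (X ⟶ Y) → Prop
  | id (X : C) : Proj (𝟙 X)
  | comp {X Y Z : C} {f : X ⟶ Y} {g : Y ⟶ Z} : Proj f → Proj g → Proj (f ≫ g)
  | box {X X' Y Y' : C} {f : X ⟶ X'} {g : Y ⟶ Y'} : Proj f → Proj g → Proj (P.map f g)
  | p₀ (X Y : C) : Proj (P.p₀ X Y)
  | p₁ (X Y : C) : Proj (P.p₁ X Y)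

/-- The laws of a P-category. -/
structure IsPCategory : Prop where
  /-- `⊠` is a functor of two variables -/
  map_id : ∀ X Y : C, P.map (𝟙 X) (𝟙 Y) = 𝟙 (P.obj X Y)
  map_comp : ∀ {X X' X'' Y Y' Y'' : C} (f : X ⟶ X') (f' : X' ⟶ X'') (g : Y ⟶ Y') (g' : Y' ⟶ Y''),
    P.map (f ≫ f') (g ≫ g') = P.map f g ≫ P.map f' g'
  /-- `Δ` is natural -/
  diag_natural : ∀ {X Y : C} (f : X ⟶ Y), f ≫ P.diag Y = P.diag X ≫ P.map f f
  /-- the triangles relating `Δ` to the projections -/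
  diag_p₀ : ∀ X : C, P.diag X ≫ P.p₀ X X = 𝟙 X
  diag_p₁ : ∀ X : C, P.diag X ≫ P.p₁ X X = 𝟙 X
  diag_map_p₀_p₁ : ∀ X Y : C,
    P.diag (P.obj X Y) ≫ P.map (P.p₀ X Y) (P.p₁ X Y) = 𝟙 (P.obj X Y)
  /-- `p₀` is natural at `(f, g)` if `g` is in the subcategory generated by the projections -/
  p₀_natural : ∀ {X X' Y Y' : C} (f : X ⟶ X') (g : Y ⟶ Y'), P.Proj g →
    P.map f g ≫ P.p₀ X' Y' = P.p₀ X Y ≫ f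
  /-- `p₁` is natural at `(f, g)` if `f` is in the subcategory generated by the projections -/
  p₁_natural : ∀ {X X' Y Y' : C} (f : X ⟶ X') (g : Y ⟶ Y'), P.Proj f →
    P.map f g ≫ P.p₁ X' Y' = P.p₁ X Y ≫ g
  /-- associativity is a natural isomorphism -/
  ass_isIso : ∀ X Y Z : C, IsIso (P.ass X Y Z)
  ass_natural : ∀ {X X' Y Y' Z Z' : C} (f : X ⟶ X') (g : Y ⟶ Y') (h : Z ⟶ Z'),
    P.map (P.map f g) h ≫ P.ass X' Y' Z' = P.ass X Y Z ≫ P.map f (P.map g h)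
  /-- transposition is a natural isomorphism, with `tr ∘ tr = 1` -/
  tr_tr : ∀ X Y : C, P.tr X Y ≫ P.tr Y X = 𝟙 (P.obj X Y)
  tr_natural : ∀ {X X' Y Y' : C} (f : X ⟶ X') (g : Y ⟶ Y'),
    P.map f g ≫ P.tr X' Y' = P.tr X Y ≫ P.map g f
  pentagon : ∀ W X Y Z : C,
    P.map (P.ass W X Y) (𝟙 Z) ≫ P.ass W (P.obj X Y) Z ≫ P.map (𝟙 W) (P.ass X Y Z) =
      P.ass (P.obj W X) Y Z ≫ P.ass W X (P.obj Y Z)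
  hexagon : ∀ X Y Z : C,
    P.ass X Y Z ≫ P.tr X (P.obj Y Z) ≫ P.ass Y Z X =
      P.map (P.tr X Y) (𝟙 Z) ≫ P.ass Y X Z ≫ P.map (𝟙 Y) (P.tr X Z)

/-- The domain `p₀ ∘ ⟨1, f⟩` of a morphism. -/
def dom {X Y : C} (f : X ⟶ Y) : X ⟶ X :=
  P.pair (𝟙 X) f ≫ P.p₀ X Y

/-- A morphism is total if its domain is the identity. -/
def IsTotal {X Y : C} (f : X ⟶ Y) : Prop :=
  P.dom f = 𝟙 X

end NearProduct

/-- A morphism `f` of a pointed category is weakly total if `f φ = 0` implies `φ = 0`. -/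
def IsWeaklyTotal {C : Type u} [Category.{v} C] [HasZeroMorphisms C] {X Y : C} (f : X ⟶ Y) : Prop :=
  ∀ ⦃W : C⦄ (φ : W ⟶ X), φ ≫ f = 0 → φ = 0

/-- A pointed category with near product data is prodominical if it is a P-category and
`φ ⊠ 0 = 0` for all `φ`. (`HasZeroMorphisms C` is a system of zero morphisms; it is unique.) -/
structure NearProduct.IsProdominical {C : Type u} [Category.{v} C] [HasZeroMorphisms C]
    (P : NearProduct C) : Prop where
  isPCategory : P.IsPCategory
  map_zero : ∀ {A B : C} (φ : A ⟶ B) (X Y : C), P.map φ (0 : X ⟶ Y) = 0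

/-- A prodominical category is dominical if every weakly total morphism is total and
`φ ⊠ ψ = 0` implies `φ = 0` or `ψ = 0`. -/
structure NearProduct.IsDominical {C : Type u} [Category.{v} C] [HasZeroMorphisms C]
    (P : NearProduct C) : Prop extends P.IsProdominical where
  isTotal_of_isWeaklyTotal : ∀ {X Y : C} (f : X ⟶ Y), IsWeaklyTotal f → P.IsTotal f
  eq_zero_or_eq_zero : ∀ {A B X Y : C} (φ : A ⟶ B) (ψ : X ⟶ Y), P.map φ ψ = 0 → φ = 0 ∨ ψ = 0

/-- The box product on the category of partial maps of `C`, extending the product of `C`; the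
diagonals and projections are those of `C`, regarded as everywhere defined partial morphisms. -/
def Par.box (C : Type u) [Category.{v} C] [HasFiniteLimits C] : NearProduct (Par C) where
  obj X Y := ⟨X.as ⨯ Y.as⟩
  map a b := PartialMor.boxMap a b
  diag X := PartialMor.mk (𝟙 X.as) (Limits.diag X.as)
  p₀ X Y := PartialMor.mk (𝟙 (X.as ⨯ Y.as)) prod.fst
  p₁ X Y := PartialMor.mk (𝟙 (X.as ⨯ Y.as)) prod.snd

/-! ### Coalgebras and partial morphisms -/

section Pfn

variable (F : Type u ⥤ Type u)

/-- The category of `F`-coalgebras and partial morphisms. -/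
abbrev Pfn := Par (Endofunctor.Coalgebra F)

/-- The box product on `Pfn F`, extending the product of `F`-coalgebras. -/
abbrev Pfn.box [HasFiniteLimits (Endofunctor.Coalgebra F)] : NearProduct (Pfn F) :=
  Par.box (Endofunctor.Coalgebra F)

/-- The unique coalgebra on the empty set. -/
def emptyCoalgebra : Endofunctor.Coalgebra F where
  V := PEmpty
  str := TypeCat.ofHom PEmpty.elim

/-- The empty map `∅ → A`. -/
def fromEmpty (A : Endofunctor.Coalgebra F) : emptyCoalgebra F ⟶ A where
  f := TypeCat.ofHom PEmpty.elim
  h := by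
    ext x
    exact PEmpty.elim x

variable {F}

/-- A coalgebra that maps to the empty coalgebra is isomorphic to it. -/
def isoEmptyCoalgebra {A : Endofunctor.Coalgebra F} (t : A ⟶ emptyCoalgebra F) :
    A ≅ emptyCoalgebra F where
  hom := t
  inv := fromEmpty F A
  hom_inv_id := by
    ext x
    exact PEmpty.elim (t.f x)
  inv_hom_id := by
    ext x
    exact PEmpty.elim x

theorem hom_ext_of_toEmpty {A B : Endofunctor.Coalgebra F} (t : A ⟶ emptyCoalgebra F)
    (f g : A ⟶ B) : f = g := by
  ext x
  exact PEmpty.elim (t.f x)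

instance mono_fromEmpty (A : Endofunctor.Coalgebra F) : Mono (fromEmpty F A) :=
  ⟨fun g h _ => hom_ext_of_toEmpty g g h⟩

theorem PartialMor.mk_eq_of_toEmpty {A B U : Endofunctor.Coalgebra F} (t : U ⟶ emptyCoalgebra F)
    (m : U ⟶ A) [Mono m] (φ : U ⟶ B) :
    PartialMor.mk m φ = PartialMor.mk (fromEmpty F A) (fromEmpty F B) :=
  PartialMor.mk_eq (isoEmptyCoalgebra t) (hom_ext_of_toEmpty t _ _) (hom_ext_of_toEmpty t _ _)

/-- The zero morphism `A ⇀ B` is the class of the pair of empty maps `A ← ∅ → B`. -/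
instance Pfn.hasZeroMorphisms [HasFiniteLimits (Endofunctor.Coalgebra F)] :
    HasZeroMorphisms (Pfn F) where
  zero A B := ⟨PartialMor.mk (fromEmpty F A.as) (fromEmpty F B.as)⟩
  comp_zero {X Y} a Z := by
    induction a using PartialMor.ind with
    | h U m φ =>
      have : Mono (pullback.fst φ (fromEmpty F Y.as) ≫ m) := mono_comp _ _
      exact (PartialMor.comp_mk (IsPullback.of_hasPullback φ (fromEmpty F Y.as))).trans
        (PartialMor.mk_eq_of_toEmpty (pullback.snd φ (fromEmpty F Y.as)) _ _)
  zero_comp X {Y Z} b := by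
    induction b using PartialMor.ind with
    | h V n ψ =>
      have : Mono (pullback.fst (fromEmpty F Y.as) n ≫ fromEmpty F X.as) := mono_comp _ _
      exact (PartialMor.comp_mk (IsPullback.of_hasPullback (fromEmpty F Y.as) n)).trans
        (PartialMor.mk_eq_of_toEmpty (pullback.fst (fromEmpty F Y.as) n) _ _)

end Pfn

end

noncomputable section

/-! ### Partial maps form a P-category -/

section PartialMorphisms

variable {C : Type u} [Category.{v} C] [HasFiniteLimits C]

attribute [local simp] prod.lift_fst prod.lift_snd prod.lift_fst_assoc prod.lift_snd_assoc

/-! The counterexample pairs a state without successors with a state that loops on itself. A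
morphism of `finPowerset`-coalgebras carries the successor set of a state onto that of its image, so
a state mapping to both would have no successors and at least one. Hence the product of the two
coalgebras is empty (`isEmpty_of_hom_deadlock_of_hom_loop`). Their identities are nonzero, but the
box product of these identities has an empty domain and so is zero.

The rest is general. Over any category with finite limits, the P-category laws are checked on
representatives: composites may be computed with any pullback square, so naturality reduces to
exhibiting squares built from products, and coherence is inherited from the cartesian structure
(`Par.isPCategory_box`).

Finite limits of coalgebras come from the special adjoint functor theorem: colimits are computed on
carriers, quotients are determined by their kernels, and boundedness gives a small separating family
(`hasLimits_of_isBounded`). -/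

theorem isPullback_prod_map {P X Y Z P' X' Y' Z' : C}
    {f : P ⟶ X} {g : P ⟶ Y} {h : X ⟶ Z} {k : Y ⟶ Z}
    {f' : P' ⟶ X'} {g' : P' ⟶ Y'} {h' : X' ⟶ Z'} {k' : Y' ⟶ Z'}
    (s : IsPullback f g h k) (s' : IsPullback f' g' h' k') :
    IsPullback (prod.map f f') (prod.map g g') (prod.map h h') (prod.map k k') := by
  refine ⟨⟨by simp [s.w, s'.w]⟩, ⟨PullbackCone.IsLimit.mk _
    (fun c => prod.lift
      (s.lift (c.fst ≫ prod.fst) (c.snd ≫ prod.fst) (by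
        simpa using congrArg (· ≫ prod.fst) c.condition))
      (s'.lift (c.fst ≫ prod.snd) (c.snd ≫ prod.snd) (by
        simpa using congrArg (· ≫ prod.snd) c.condition))) ?_ ?_ ?_⟩⟩
  · intro c
    ext <;> simp
  · intro c
    ext <;> simp
  · intro c m hm₁ hm₂
    ext
    · apply s.hom_ext <;> simp [← hm₁, ← hm₂]
    · apply s'.hom_ext <;> simp [← hm₁, ← hm₂]

/-- Since `m` is monic, two elements of `U` over the same `x` coincide. This is what makes the
diagonal natural for partial morphisms. -/
theorem isPullback_diag_prod_map {X U : C} (m : U ⟶ X) [Mono m] :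
    IsPullback m (diag U) (diag X) (prod.map m m) := by
  refine ⟨⟨by simp⟩, ⟨PullbackCone.IsLimit.mk _ (fun c => c.snd ≫ prod.fst) ?_ ?_ ?_⟩⟩
  · intro c
    simpa using (congrArg (· ≫ prod.fst) c.condition).symm
  · intro c
    have h₀ : c.fst = c.snd ≫ prod.fst ≫ m := by
      simpa using congrArg (· ≫ prod.fst) c.condition
    have h₁ : c.fst = c.snd ≫ prod.snd ≫ m := by
      simpa using congrArg (· ≫ prod.snd) c.condition
    have h : c.snd ≫ prod.fst = c.snd ≫ prod.snd := by
      rw [← cancel_mono m, Category.assoc, Category.assoc, ← h₀, h₁]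
    ext
    · simp
    · simp [h]
  · intro c t _ ht
    simp [← ht]

/-! ### Total morphisms and naturality of the box product. -/

namespace PartialMor

/-- A morphism of `C`, regarded as an everywhere defined partial morphism. -/
def total {X Y : C} (f : X ⟶ Y) : PartialMor X Y :=
  mk (𝟙 X) f

theorem mk_comp_total {X Y Z U : C} (m : U ⟶ X) [Mono m] (φ : U ⟶ Y) (g : Y ⟶ Z) :
    comp (mk m φ) (total g) = mk m (φ ≫ g) := by
  have h : IsPullback (𝟙 U) φ φ (𝟙 Y) := IsPullback.of_horiz_isIso ⟨by simp⟩
  exact (comp_mk h).trans (mk_eq (Iso.refl _) (by simp) (by simp))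

/-- Each naturality law below supplies its own convenient pullback square here. -/
theorem total_comp_mk {X Y Z U V : C} {f : X ⟶ Y} {n : V ⟶ Y} [Mono n] {p : U ⟶ X} [Mono p]
    {q : U ⟶ V} (h : IsPullback p q f n) (ψ : V ⟶ Z) :
    comp (total f) (mk n ψ) = mk p (q ≫ ψ) :=
  have : Mono (p ≫ 𝟙 X) := by simpa
  (comp_mk h).trans (mk_eq (Iso.refl _) (by simp) (by simp))

theorem total_comp_total {X Y Z : C} (f : X ⟶ Y) (g : Y ⟶ Z) :
    comp (total f) (total g) = total (f ≫ g) :=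
  mk_comp_total _ _ _

theorem boxMap_mk {X X' Y Y' U V : C} (m : U ⟶ X) [Mono m] (φ : U ⟶ X') (n : V ⟶ Y) [Mono n]
    (ψ : V ⟶ Y') : boxMap (mk m φ) (mk n ψ) = mk (prod.map m n) (prod.map φ ψ) :=
  rfl

theorem boxMap_total {X X' Y Y' : C} (f : X ⟶ X') (g : Y ⟶ Y') :
    boxMap (total f) (total g) = total (prod.map f g) :=
  mk_eq (Iso.refl _) (by simp) (by simp)

theorem diag_comp_boxMap_total {X Y Z : C} (f : X ⟶ Y) (g : X ⟶ Z) :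
    comp (total (diag X)) (boxMap (total f) (total g)) = total (prod.lift f g) := by
  rw [boxMap_total, total_comp_total]
  simp

theorem boxMap_comp {X X' X'' Y Y' Y'' : C} (a : PartialMor X X') (a' : PartialMor X' X'')
    (b : PartialMor Y Y') (b' : PartialMor Y' Y'') :
    boxMap (comp a a') (comp b b') = comp (boxMap a b) (boxMap a' b') := by
  induction a using ind with
  | h U m φ =>
  induction a' using ind with
  | h U' m' φ' =>
  induction b using ind with
  | h V n ψ =>
  induction b' using ind with
  | h V' n' ψ' =>
    have hU := IsPullback.of_hasPullback φ m'
    have hV := IsPullback.of_hasPullback ψ n'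
    have : Mono (pullback.fst φ m' ≫ m) := mono_comp _ _
    have : Mono (pullback.fst ψ n' ≫ n) := mono_comp _ _
    have : Mono (prod.map (pullback.fst φ m') (pullback.fst ψ n') ≫ prod.map m n) := by
      rw [prod.map_map]
      infer_instance
    rw [comp_mk hU, comp_mk hV, boxMap_mk, boxMap_mk, boxMap_mk,
      comp_mk (isPullback_prod_map hU hV)]
    exact mk_eq (Iso.refl _) (by simp) (by simp)

theorem comp_total_diag {X Y : C} (a : PartialMor X Y) :
    comp a (total (diag Y)) = comp (total (diag X)) (boxMap a a) := by
  induction a using ind with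
  | h U m φ =>
    rw [mk_comp_total, boxMap_mk, total_comp_mk (isPullback_diag_prod_map m)]
    simp

/-- Totality of `g` is essential: a partial second factor would also restrict the domain of the left
side. Here both sides have domain `U ⨯ Y`. -/
theorem boxMap_total_comp_fst {X X' Y Y' : C} (a : PartialMor X X') (g : Y ⟶ Y') :
    comp (boxMap a (total g)) (total prod.fst) = comp (total prod.fst) a := by
  induction a using ind with
  | h U m φ =>
    have h : IsPullback (prod.map m (𝟙 Y)) prod.fst prod.fst m := by
      refine ⟨⟨by simp⟩, ⟨PullbackCone.IsLimit.mk _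
        (fun c => prod.lift c.snd (c.fst ≫ prod.snd)) ?_ ?_ ?_⟩⟩
      · intro c
        ext <;> simp [c.condition]
      · simp
      · intro c t h₁ h₂
        ext <;> simp [← h₁, ← h₂]
    rw [total_comp_mk h, total, boxMap_mk, mk_comp_total]
    simp

theorem boxMap_comp_braiding {X X' Y Y' : C} (a : PartialMor X X') (b : PartialMor Y Y') :
    comp (boxMap a b) (total (prod.braiding X' Y').hom) =
      comp (total (prod.braiding X Y).hom) (boxMap b a) := by
  induction a using ind with
  | h U m φ =>
  induction b using ind with
  | h V n ψ =>
    have h : IsPullback (prod.map m n) (prod.braiding U V).hom (prod.braiding X Y).hom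
        (prod.map n m) := IsPullback.of_vert_isIso ⟨by simp⟩
    rw [boxMap_mk, boxMap_mk, mk_comp_total, total_comp_mk h]
    simp

theorem boxMap_comp_associator {X X' Y Y' Z Z' : C} (a : PartialMor X X') (b : PartialMor Y Y')
    (c : PartialMor Z Z') :
    comp (boxMap (boxMap a b) c) (total (prod.associator X' Y' Z').hom) =
      comp (total (prod.associator X Y Z).hom) (boxMap a (boxMap b c)) := by
  induction a using ind with
  | h U m φ =>
  induction b using ind with
  | h V n ψ =>
  induction c using ind with
  | h W k χ =>
    have h : IsPullback (prod.map (prod.map m n) k) (prod.associator U V W).hom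
        (prod.associator X Y Z).hom (prod.map m (prod.map n k)) :=
      IsPullback.of_vert_isIso ⟨prod.associator_naturality m n k⟩
    simp only [boxMap_mk]
    rw [mk_comp_total, total_comp_mk h, prod.associator_naturality]

theorem boxMap_total_comp_snd {X X' Y Y' : C} (f : X ⟶ X') (b : PartialMor Y Y') :
    comp (boxMap (total f) b) (total prod.snd) = comp (total prod.snd) b := by
  induction b using ind with
  | h V n ψ =>
    have h : IsPullback (prod.map (𝟙 X) n) prod.snd prod.snd n := by
      refine ⟨⟨by simp⟩, ⟨PullbackCone.IsLimit.mk _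
        (fun c => prod.lift (c.fst ≫ prod.fst) c.snd) ?_ ?_ ?_⟩⟩
      · intro c
        ext <;> simp [c.condition]
      · simp
      · intro c t h₁ h₂
        ext <;> simp [← h₁, ← h₂]
    rw [total_comp_mk h, total, boxMap_mk, mk_comp_total]
    simp

end PartialMor

/-! ### The P-category laws. -/

open PartialMor

/-- Only total morphisms enter the definition, so the computation takes place in `C`; the pentagon
and hexagon then become those of the cartesian product. -/
theorem Par.box_ass (X Y Z : Par C) :
    (Par.box C).ass X Y Z = total (prod.associator X.as Y.as Z.as).hom := by
  change comp (total (diag _)) (boxMap (comp (total prod.fst) (total prod.fst))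
    (comp (total (diag _)) (boxMap (comp (total prod.fst) (total prod.snd)) (total prod.snd)))) = _
  simp only [total_comp_total, diag_comp_boxMap_total]
  rfl

theorem Par.box_tr (X Y : Par C) :
    (Par.box C).tr X Y = total (prod.braiding X.as Y.as).hom := by
  change comp (total (diag _)) (boxMap (total prod.snd) (total prod.fst)) = _
  rw [diag_comp_boxMap_total]
  rfl

theorem Par.exists_eq_total_of_proj {X Y : Par C} {f : X ⟶ Y} (hf : (Par.box C).Proj f) :
    ∃ g : X.as ⟶ Y.as, f = total g := by
  induction hf with
  | id X => exact ⟨𝟙 X.as, rfl⟩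
  | comp _ _ ihf ihg =>
    obtain ⟨f, rfl⟩ := ihf
    obtain ⟨g, rfl⟩ := ihg
    exact ⟨f ≫ g, total_comp_total f g⟩
  | box _ _ ihf ihg =>
    obtain ⟨f, rfl⟩ := ihf
    obtain ⟨g, rfl⟩ := ihg
    exact ⟨prod.map f g, boxMap_total f g⟩
  | p₀ X Y => exact ⟨prod.fst, rfl⟩
  | p₁ X Y => exact ⟨prod.snd, rfl⟩

/-- The partial maps of a category with finite limits form a P-category. -/
theorem Par.isPCategory_box (C : Type u) [Category.{v} C] [HasFiniteLimits C] :
    (Par.box C).IsPCategory where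
  map_id X Y := (boxMap_total (𝟙 X.as) (𝟙 Y.as)).trans (congrArg total prod.map_id_id)
  map_comp f f' g g' := boxMap_comp f f' g g'
  diag_natural f := comp_total_diag f
  diag_p₀ X := (total_comp_total (diag X.as) prod.fst).trans (congrArg total (by simp))
  diag_p₁ X := (total_comp_total (diag X.as) prod.snd).trans (congrArg total (by simp))
  diag_map_p₀_p₁ X Y :=
    (diag_comp_boxMap_total (X := X.as ⨯ Y.as) prod.fst prod.snd).trans
      (congrArg total prod.lift_fst_snd)
  p₀_natural f g hg := by
    obtain ⟨g, rfl⟩ := Par.exists_eq_total_of_proj hg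
    exact boxMap_total_comp_fst f g
  p₁_natural f g hf := by
    obtain ⟨f, rfl⟩ := Par.exists_eq_total_of_proj hf
    exact boxMap_total_comp_snd f g
  ass_isIso X Y Z := by
    rw [Par.box_ass]
    exact ⟨total (prod.associator X.as Y.as Z.as).inv,
      (total_comp_total _ _).trans (congrArg total (Iso.hom_inv_id _)),
      (total_comp_total _ _).trans (congrArg total (Iso.inv_hom_id _))⟩
  ass_natural f g h := by
    rw [Par.box_ass, Par.box_ass]
    exact boxMap_comp_associator f g h
  tr_tr X Y := by
    rw [Par.box_tr, Par.box_tr]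
    exact (total_comp_total _ _).trans (congrArg total (prod.symmetry' _ _))
  tr_natural f g := by
    rw [Par.box_tr, Par.box_tr]
    exact boxMap_comp_braiding f g
  pentagon W X Y Z := by
    rw [Par.box_ass, Par.box_ass, Par.box_ass, Par.box_ass, Par.box_ass]
    change comp (boxMap (total (prod.associator W.as X.as Y.as).hom) (total (𝟙 Z.as)))
        (comp (total (prod.associator W.as (X.as ⨯ Y.as) Z.as).hom)
          (boxMap (total (𝟙 W.as)) (total (prod.associator X.as Y.as Z.as).hom))) =
      comp (total (prod.associator (W.as ⨯ X.as) Y.as Z.as).hom)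
        (total (prod.associator W.as X.as (Y.as ⨯ Z.as)).hom)
    rw [boxMap_total, boxMap_total, total_comp_total, total_comp_total, total_comp_total,
      prod.pentagon]
  hexagon X Y Z := by
    rw [Par.box_ass, Par.box_ass, Par.box_ass, Par.box_tr, Par.box_tr, Par.box_tr]
    change comp (total (prod.associator X.as Y.as Z.as).hom)
        (comp (total (prod.braiding X.as (Y.as ⨯ Z.as)).hom)
          (total (prod.associator Y.as Z.as X.as).hom)) =
      comp (boxMap (total (prod.braiding X.as Y.as).hom) (total (𝟙 Z.as)))
        (comp (total (prod.associator Y.as X.as Z.as).hom)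
          (boxMap (total (𝟙 Y.as)) (total (prod.braiding X.as Z.as).hom)))
    rw [boxMap_total, boxMap_total, total_comp_total, total_comp_total, total_comp_total,
      total_comp_total]
    refine congrArg total ?_
    ext <;> simp

end PartialMorphisms

theorem Pfn.isProdominical_box (F : Type u ⥤ Type u) [HasFiniteLimits (Endofunctor.Coalgebra F)] :
    (Pfn.box F).IsProdominical where
  isPCategory := Par.isPCategory_box _
  map_zero {A B} φ X Y := by
    induction φ using PartialMor.ind with
    -- The domain of `φ ⊠ 0` is `U ⨯ ∅`, which projects to `∅` and is therefore empty.
    | h U m φ => exact PartialMor.mk_eq_of_toEmpty prod.snd _ _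

/-! ### Colimits and limits of coalgebras -/

namespace CategoryTheory.Endofunctor.Coalgebra

variable {F : Type u ⥤ Type u}

theorem comp_str_map {A B : Coalgebra F} (f : A ⟶ B) {T : Type u} {a : A.V ⟶ T} {b : B.V ⟶ T}
    (w : f.f ≫ b = a) : f.f ≫ B.str ≫ F.map b = A.str ≫ F.map a := by
  rw [← Hom.h_assoc, ← F.map_comp, w]

/-- The map `d` need not be a morphism: this is its morphism equation tested along `i`, which
suffices for a map out of a colimit when `i` runs over the injections. -/
theorem comp_str_map_eq {A B P : Coalgebra F} (i : A ⟶ P) (k : A ⟶ B) {d : P.V ⟶ B.V}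
    (w : i.f ≫ d = k.f) : i.f ≫ P.str ≫ F.map d = i.f ≫ d ≫ B.str := by
  rw [comp_str_map i w, reassoc_of% w, k.h]

section Colimits

variable {J : Type u} [Category.{v} J] [HasColimitsOfShape J (Type u)] (D : J ⥤ Coalgebra F)

/-- The structure maps of a diagram of coalgebras, followed by `F` of the colimit injections. -/
def strCocone : Cocone (D ⋙ forget F) where
  pt := F.obj (colimit (D ⋙ forget F))
  ι :=
    { app j := (D.obj j).str ≫ F.map (colimit.ι (D ⋙ forget F) j)
      naturality i j f := by
        have w : (D.map f).f ≫ colimit.ι (D ⋙ forget F) j = colimit.ι (D ⋙ forget F) i :=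
          colimit.w (D ⋙ forget F) f
        exact (comp_str_map (D.map f) w).trans (Category.comp_id _).symm }

/-- The colimit of the carriers of a diagram of coalgebras, with its coalgebra structure. -/
def colimitCocone : Cocone D where
  pt :=
    { V := colimit (D ⋙ forget F)
      str := colimit.desc (D ⋙ forget F) (strCocone D) }
  ι :=
    { app j :=
        { f := colimit.ι (D ⋙ forget F) j
          h := (colimit.ι_desc (strCocone D) j).symm }
      naturality i j f := by
        ext1
        exact (colimit.w (D ⋙ forget F) f).trans (Category.comp_id _).symm }

/-- The colimit of the carriers is a colimit of coalgebras. -/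
def colimitCoconeIsColimit : IsColimit (colimitCocone D) where
  desc s :=
    { f := colimit.desc (D ⋙ forget F) ((forget F).mapCocone s)
      h := by
        apply colimit.hom_ext
        intro j
        exact comp_str_map_eq ((colimitCocone D).ι.app j) (s.ι.app j) (colimit.ι_desc _ j) }
  fac s j := by
    ext1
    exact colimit.ι_desc _ j
  uniq s m hm := by
    ext1
    apply colimit.hom_ext
    intro j
    exact (congrArg Hom.f (hm j)).trans (colimit.ι_desc ((forget F).mapCocone s) j).symm

end Colimits

instance hasColimits : HasColimits (Coalgebra F) where
  has_colimits_of_shape _ _ := ⟨fun D => ⟨⟨_, colimitCoconeIsColimit D⟩⟩⟩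

instance forget_preservesColimits : PreservesColimits (forget F) where
  preservesColimitsOfShape := ⟨fun {D} => preservesColimit_of_preserves_colimit_cocone
    (colimitCoconeIsColimit D) (IsColimit.ofIsoColimit (colimit.isColimit (D ⋙ forget F))
      (Cocone.ext (Iso.refl _) fun _ => Category.comp_id _))⟩

/-! ### Quotients, separating families and limits. -/

/-- The forgetful functor preserves colimits, hence epimorphisms. -/
theorem surjective_of_epi {A B : Coalgebra F} (e : A ⟶ B) [Epi e] : Function.Surjective e.f :=
  (epi_iff_surjective _).1 (inferInstanceAs (Epi ((forget F).map e)))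

/-- A morphism that identifies all pairs identified by an epimorphism factors through it. -/
theorem exists_factor_of_epi {A B B' : Coalgebra F} (e : A ⟶ B) [Epi e] (g : A ⟶ B')
    (h : ∀ x y, e.f x = e.f y → g.f x = g.f y) : ∃ k : B ⟶ B', e ≫ k = g := by
  have he := surjective_of_epi e
  have hk : e.f ≫ TypeCat.ofHom (fun b => g.f (Function.surjInv he b)) = g.f := by
    ext x
    exact h _ _ (Function.surjInv_eq he (e.f x))
  have : Epi e.f := (epi_iff_surjective _).2 he
  refine ⟨{ f := TypeCat.ofHom fun b => g.f (Function.surjInv he b), h := ?_ }, ?_⟩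
  -- The morphism equation for the factor may be checked after the surjection `e.f`.
  · rw [← cancel_epi e.f, ← Hom.h_assoc, ← F.map_comp, hk, reassoc_of% hk, g.h]
  · ext1
    exact hk

/-- A quotient of `X` is determined by its kernel, a subset of the square of the carrier. -/
instance wellPowered_op : WellPowered.{u} (Coalgebra F)ᵒᵖ where
  subobject_small X := by
    let ker (P : Subobject X) : Set (X.unop.V × X.unop.V) :=
      {x | P.arrow.unop.f x.1 = P.arrow.unop.f x.2}
    have le {P Q : Subobject X} (h : ker P = ker Q) : P ≤ Q := by
      obtain ⟨k, hk⟩ := exists_factor_of_epi Q.arrow.unop P.arrow.unop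
        (fun x y hxy => (Set.ext_iff.1 h (x, y)).2 hxy)
      exact Subobject.le_of_comm k.op (Quiver.Hom.unop_inj hk)
    exact small_of_injective (f := ker) fun P Q h => le_antisymm (le h) (le h.symm)

/-- The coalgebras whose carrier is a subset of `K`. -/
def ofSubset (F : Type u ⥤ Type u) (K : Type u)
    (S : Σ S : Set K, ((S : Type u) ⟶ F.obj S)) : Coalgebra F where
  V := S.1
  str := S.2

/-- Any state lies in a subcoalgebra small enough to be transported to a subset of `K`, so morphisms
agreeing on all such coalgebras agree at every state. -/
theorem isSeparating_ofSubset {K : Type u}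
    (hK : ∀ (A : Coalgebra F) (a : A.V),
      ∃ U : Set A.V, a ∈ U ∧ SetEndofunctor.IsSubcoalgebra A U ∧ Cardinal.mk U ≤ Cardinal.mk K) :
    (ObjectProperty.ofObj (ofSubset F K)).IsSeparating := by
  intro A B f g hfg
  ext a
  obtain ⟨U, haU, ⟨β, hβ⟩, hU⟩ := hK A a
  obtain ⟨i⟩ := hU
  let e : (U : Type u) ≅ (Set.range i : Type u) := (Equiv.ofInjective i i.injective).toIso
  let S : Σ S : Set K, ((S : Type u) ⟶ F.obj S) := ⟨Set.range i, e.inv ≫ β ≫ F.map e.hom⟩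
  let incl : ofSubset F K S ⟶ A :=
    { f := e.inv ≫ TypeCat.ofHom Subtype.val
      h := by
        have h : (e.inv ≫ β ≫ F.map e.hom) ≫ F.map (e.inv ≫ TypeCat.ofHom Subtype.val) =
            (e.inv ≫ TypeCat.ofHom Subtype.val) ≫ A.str := by
          rw [Category.assoc, Category.assoc, Category.assoc, ← F.map_comp, e.hom_inv_id_assoc, hβ]
        exact h }
  have h := congrArg (fun k => k.f (e.hom ⟨a, haU⟩))
    (hfg _ (ObjectProperty.ofObj_apply (ofSubset F K) S) incl)
  have he : e.inv (e.hom ⟨a, haU⟩) = ⟨a, haU⟩ := ConcreteCategory.congr_hom e.hom_inv_id _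
  have ha : incl.f (e.hom ⟨a, haU⟩) = a := congrArg Subtype.val he
  change f.f (incl.f (e.hom ⟨a, haU⟩)) = g.f (incl.f (e.hom ⟨a, haU⟩)) at h
  rwa [ha] at h

/-- The coalgebras of a bounded set endofunctor have all limits. -/
theorem hasLimits_of_isBounded (hF : SetEndofunctor.IsBounded F) : HasLimits (Coalgebra F) := by
  obtain ⟨κ, hκ⟩ := hF
  exact hasLimits_of_hasColimits_of_isSeparating
    (isSeparating_ofSubset (K := κ.out) (by simpa using hκ))

end CategoryTheory.Endofunctor.Coalgebra

/-! ### The finite powerset functor -/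

theorem finPowerset_isNontrivial : SetEndofunctor.IsNontrivial finPowerset.{u} :=
  fun _ h => (h.false ⟨∅, Set.finite_empty⟩).elim

/-- If `f` and `g` send `S` and `T` to the same set, the pairs of the pullback lying in `S × T` form
a finite set projecting onto both. -/
theorem finPowerset_weaklyPreservesPullbacks :
    SetEndofunctor.WeaklyPreservesPullbacks finPowerset.{u} := by
  rintro X Y Z f g (c : PullbackCone f g) ⟨hc⟩
  -- Maps out of a one-point set turn the universal property into a statement about elements.
  have hex (x : X) (y : Y) (h : f x = g y) : ∃ p : c.pt, c.fst p = x ∧ c.snd p = y := by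
    obtain ⟨l, hl₁, hl₂⟩ := PullbackCone.IsLimit.lift' hc
      (TypeCat.ofHom fun _ : PUnit.{u + 1} => x) (TypeCat.ofHom fun _ => y) (by ext; exact h)
    exact ⟨l PUnit.unit, ConcreteCategory.congr_hom hl₁ PUnit.unit,
      ConcreteCategory.congr_hom hl₂ PUnit.unit⟩
  -- This serves the finiteness of `W`.
  have hinj : Function.Injective fun p : c.pt => (c.fst p, c.snd p) := by
    intro p q h
    have : TypeCat.ofHom (fun _ : PUnit.{u + 1} => p) = TypeCat.ofHom fun _ => q :=
      PullbackCone.IsLimit.hom_ext hc (by ext; exact congrArg Prod.fst h)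
        (by ext; exact congrArg Prod.snd h)
    exact ConcreteCategory.congr_hom this PUnit.unit
  let W (S : finPowerset.obj X) (T : finPowerset.obj Y) : finPowerset.obj c.pt :=
    ⟨(fun p : c.pt => (c.fst p, c.snd p)) ⁻¹' S.1 ×ˢ T.1,
      (S.2.prod T.2).preimage hinj.injOn⟩
  have hfst (S : finPowerset.obj X) (T : finPowerset.obj Y)
      (h : finPowerset.map f S = finPowerset.map g T) : finPowerset.map c.fst (W S T) = S := by
    refine Subtype.ext (Set.Subset.antisymm ?_ fun x hx => ?_)
    · rintro _ ⟨p, hp, rfl⟩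
      exact hp.1
    · have hfx : f x ∈ (finPowerset.map g T).1 := h ▸ ⟨x, hx, rfl⟩
      obtain ⟨y, hy, hxy⟩ := hfx
      obtain ⟨p, rfl, rfl⟩ := hex x y hxy.symm
      exact ⟨p, ⟨hx, hy⟩, rfl⟩
  have hsnd (S : finPowerset.obj X) (T : finPowerset.obj Y)
      (h : finPowerset.map f S = finPowerset.map g T) : finPowerset.map c.snd (W S T) = T := by
    refine Subtype.ext (Set.Subset.antisymm ?_ fun y hy => ?_)
    · rintro _ ⟨p, hp, rfl⟩
      exact hp.2
    · have hgy : g y ∈ (finPowerset.map f S).1 := h ▸ ⟨y, hy, rfl⟩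
      obtain ⟨x, hx, hxy⟩ := hgy
      obtain ⟨p, rfl, rfl⟩ := hex x y hxy
      exact ⟨p, ⟨hx, hy⟩, rfl⟩
  have hw (s : Cone (cospan f g ⋙ finPowerset)) :
      s.π.app WalkingCospan.left ≫ finPowerset.map f =
        s.π.app WalkingCospan.right ≫ finPowerset.map g :=
    (s.w WalkingCospan.Hom.inl).trans (s.w WalkingCospan.Hom.inr).symm
  have hl (s : Cone (cospan f g ⋙ finPowerset)) :
      TypeCat.ofHom (fun z => W (s.π.app WalkingCospan.left z) (s.π.app WalkingCospan.right z)) ≫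
        finPowerset.map c.fst = s.π.app WalkingCospan.left := by
    refine ConcreteCategory.hom_ext _ _ fun z => ?_
    exact hfst _ _ (ConcreteCategory.congr_hom (hw s) z)
  refine ⟨⟨fun s => TypeCat.ofHom fun z =>
    W (s.π.app WalkingCospan.left z) (s.π.app WalkingCospan.right z), ?_⟩⟩
  rintro s (_ | _ | _)
  · have hc₁ : ((finPowerset.mapCone c).π.app WalkingCospan.left ≫ finPowerset.map f) =
        (finPowerset.mapCone c).π.app WalkingCospan.one :=
      (finPowerset.mapCone c).w WalkingCospan.Hom.inl
    have hs₁ : s.π.app WalkingCospan.left ≫ finPowerset.map f = s.π.app WalkingCospan.one :=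
      s.w WalkingCospan.Hom.inl
    exact (congrArg _ hc₁.symm).trans ((Category.assoc _ _ _).symm.trans
      ((congrArg (· ≫ finPowerset.map f) (hl s)).trans hs₁))
  · exact hl s
  · refine ConcreteCategory.hom_ext _ _ fun z => ?_
    exact hsnd _ _ (ConcreteCategory.congr_hom (hw s) z)

/-- The states reachable from `a` form a subcoalgebra, countable because every state has finitely
many successors. -/
theorem finPowerset_isBounded : SetEndofunctor.IsBounded finPowerset.{u} := by
  refine ⟨Cardinal.aleph0, fun A a => ?_⟩
  let next (U : Set A.V) : Set A.V := ⋃ x ∈ U, (A.str x).1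
  let U : Set A.V := ⋃ n, next^[n] {a}
  have hU (n : ℕ) : (next^[n] {a}).Countable := by
    induction n with
    | zero => exact Set.countable_singleton a
    | succ n ih =>
      rw [Function.iterate_succ_apply']
      exact ih.biUnion fun x _ => (A.str x).2.countable
  have hstr {x : A.V} (hx : x ∈ U) : (A.str x).1 ⊆ U := by
    obtain ⟨n, hn⟩ := Set.mem_iUnion.1 hx
    refine fun y hy => Set.mem_iUnion.2 ⟨n + 1, ?_⟩
    rw [Function.iterate_succ_apply']
    exact Set.mem_biUnion hn hy
  refine ⟨U, Set.mem_iUnion.2 ⟨0, rfl⟩, ⟨TypeCat.ofHom fun x => ⟨Subtype.val ⁻¹' (A.str x.1).1,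
    (A.str x.1).2.preimage Subtype.val_injective.injOn⟩, ?_⟩, (Set.countable_iUnion hU).le_aleph0⟩
  refine ConcreteCategory.hom_ext _ _ fun x => ?_
  refine Subtype.ext ?_
  -- Restricting successor sets to `U` loses nothing, as `U` is closed under successors.
  exact (Subtype.image_preimage_coe _ _).trans (Set.inter_eq_right.2 (hstr x.2))

/-! ### Two nonempty coalgebras with empty product. -/

/-- The identity partial morphism of a nonempty coalgebra is not zero. -/
theorem Pfn.id_ne_zero {F : Type u ⥤ Type u} [HasFiniteLimits (Endofunctor.Coalgebra F)]
    {A : Endofunctor.Coalgebra F} (a : A.V) : 𝟙 (Par.mk A : Pfn F) ≠ 0 := by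
  intro h
  -- Equal classes have isomorphic domains, here `A` and the empty coalgebra.
  obtain ⟨θ, _, _⟩ := Quotient.exact h
  exact PEmpty.elim (θ.hom.f a)

/-- One state without successors. -/
def deadlockCoalgebra : Endofunctor.Coalgebra finPowerset.{u} where
  V := PUnit
  str := TypeCat.ofHom fun _ => ⟨∅, Set.finite_empty⟩

/-- One state that is its own only successor. -/
def loopCoalgebra : Endofunctor.Coalgebra finPowerset.{u} where
  V := PUnit
  str := TypeCat.ofHom fun x => ⟨{x}, Set.finite_singleton x⟩

/-- The map `f` forces every state to have no successors, while `g` forces the image of its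
successor set to be a singleton. -/
theorem isEmpty_of_hom_deadlock_of_hom_loop {Z : Endofunctor.Coalgebra finPowerset.{u}}
    (f : Z ⟶ deadlockCoalgebra) (g : Z ⟶ loopCoalgebra) : IsEmpty Z.V := by
  refine ⟨fun z => ?_⟩
  have f_str := ConcreteCategory.congr_hom f.h z
  have g_str := ConcreteCategory.congr_hom g.h z
  have hf : (fun x => f.f x) '' (Z.str z).1 = ∅ :=
    congrArg Subtype.val f_str
  have hg : (fun x => g.f x) '' (Z.str z).1 = {g.f z} :=
    congrArg Subtype.val g_str
  rw [Set.image_eq_empty.1 hf, Set.image_empty] at hg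
  exact Set.singleton_ne_empty _ hg.symm

/-- An empty coalgebra maps to the empty coalgebra. -/
def toEmptyCoalgebra {F : Type u ⥤ Type u} (A : Endofunctor.Coalgebra F) [IsEmpty A.V] :
    A ⟶ emptyCoalgebra F where
  f := TypeCat.ofHom isEmptyElim
  h := ConcreteCategory.hom_ext _ _ fun x => isEmptyElim x

end

theorem mainTheorem6 :
    SetEndofunctor.IsNontrivial finPowerset.{u} ∧
    SetEndofunctor.IsBounded finPowerset.{u} ∧
    SetEndofunctor.WeaklyPreservesPullbacks finPowerset.{u} ∧
    ∃ _ : HasFiniteLimits (Endofunctor.Coalgebra finPowerset.{u}),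
      (Pfn.box finPowerset.{u}).IsProdominical ∧
      ¬ (Pfn.box finPowerset.{u}).IsDominical ∧
      ∃ A B : Endofunctor.Coalgebra finPowerset.{u},
        Finite A.V ∧ Nonempty A.V ∧ Finite B.V ∧ Nonempty B.V ∧ IsEmpty (A ⨯ B).V ∧
        ∃ (A' B' : Pfn finPowerset.{u}) (φ : Par.mk A ⟶ A') (ψ : Par.mk B ⟶ B'),
          φ ≠ 0 ∧ ψ ≠ 0 ∧ (Pfn.box finPowerset.{u}).map φ ψ = 0 := by
  have hlim := Endofunctor.Coalgebra.hasLimits_of_isBounded finPowerset_isBounded.{u}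
  have hempty : IsEmpty (deadlockCoalgebra.{u} ⨯ loopCoalgebra.{u}).V :=
    isEmpty_of_hom_deadlock_of_hom_loop prod.fst prod.snd
  have hid₀ : 𝟙 (Par.mk deadlockCoalgebra : Pfn finPowerset.{u}) ≠ 0 := Pfn.id_ne_zero PUnit.unit
  have hid₁ : 𝟙 (Par.mk loopCoalgebra : Pfn finPowerset.{u}) ≠ 0 := Pfn.id_ne_zero PUnit.unit
  -- The domain of this box product is the product coalgebra itself, which is empty.
  have hbox : (Pfn.box finPowerset.{u}).map (𝟙 (Par.mk deadlockCoalgebra))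
      (𝟙 (Par.mk loopCoalgebra)) = 0 :=
    PartialMor.mk_eq_of_toEmpty (toEmptyCoalgebra (deadlockCoalgebra ⨯ loopCoalgebra)) _ _
  exact ⟨finPowerset_isNontrivial, finPowerset_isBounded, finPowerset_weaklyPreservesPullbacks,
    inferInstance, Pfn.isProdominical_box _,
    fun h => (h.eq_zero_or_eq_zero _ _ hbox).elim hid₀ hid₁,
    deadlockCoalgebra, loopCoalgebra, inferInstanceAs (Finite PUnit), ⟨PUnit.unit⟩,
    inferInstanceAs (Finite PUnit), ⟨PUnit.unit⟩, hempty, _, _, 𝟙 _, 𝟙 _, hid₀, hid₁, hbox⟩
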